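/- Let $G$ be a finite group of order $N$, acting faithfully by permutations on $\{1,\dots,N\}$ (for instance by left translations, for some numbering of $G$). Let $X\subset\mathbb{R}^d$ be a $G$-$\mathcal{AS}$-set in linear affine form, that is: $X$ is a Boolean combination of compact arc-symmetric subsets of $\mathbb{R}^d$, its real Zariski closure is compact, and $X$ is globally stabilized by a linear action of $G$ on $\mathbb{R}^d$. (A subset $A\subset\mathbb{R}^d$ is arc-symmetric if it is semialgebraic and if every real analytic arc $\gamma:(-1,1)\to\mathbb{R}^d$ with $\gamma((-1,0))\subset A$ satisfies $\gamma((-1,1))\subset A$.) For $k\in\mathbb{N}$ let $V_N(\mathbb{R}^k)$ be the space of orthonormal $N$-frames of $\mathbb{R}^k$, let $\mathbb{R}^\infty$ be the space of finitely supported real sequences, and let $V_N(\mathbb{R}^\infty)=\varinjlim_k V_N(\mathbb{R}^k)$ be the space of its orthonormal $N$-frames, with the inductive limit topology; $G$ acts freely on these spaces by permuting the vectors of a frame. All homology and cohomology is singular with coefficients in $\mathbb{Z}_2=\mathbb{Z}/2\mathbb{Z}$. With $E_G=V_N(\mathbb{R}^\infty)$ as total space of a universal principal $G$-bundle, let $X\times_G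 E_G=(X\times E_G)/G$ be the topological quotient of the product by the diagonal action, and let $$H_*^G(X)=H_*(X\times_G E_G),\qquad H^*_G(X)=H^*(X\times_G E_G)$$ be the Borel equivariant homology and cohomology of $X$. Let $G$ act linearly on $\mathbb{R}^{N_k}=\mathbb{R}^d\times(\mathbb{R}^N)^k$, $N_k=d+Nk$, by the given action on $\mathbb{R}^d$ and by permutation of the coordinates on each $\mathbb{R}^N$, so that $X\times V_N(\mathbb{R}^k)\subset\mathbb{R}^{N_k}$ is stable. Choose for each $k$ finitely many generators $p_1,\dots,p_{m_k}$ of the $\mathbb{R}$-algebra $\mathbb{R}[X_1,\dots,X_{N_k}]^G$, compatibly: the generators at level $k+1$ are those at level $k$ followed by polynomials that vanish on $\mathbb{R}^{N_k}\subset\mathbb{R}^{N_{k+1}}$. Put $\pi_k=(p_1,\dots,p_{m_k}):\mathbb{R}^{N_k}\to\mathbb{R}^{m_k}$, and let $$X_{(k)}:=\pi_k\left(X\times V_N(\mathbb{R}^k)\right)\subset\mathbb{R}^{m_k}$$ be the geometric quotient of $X\times V_N(\mathbb{R}^k)$ by $G$. The maps $y\mapsto(y,0)$ restrict to inclusions $X_{(k)}\to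 X_{(k+1)}$, which form an inductive system. Then there are continuous maps $\iota_k:X_{(k)}\to X\times_G E_G$, compatible with the inclusions $X_{(k)}\to X_{(k+1)}$ and given by $\iota_k(\pi_k(x,v))=[x,v]$ for $x\in X$, $v\in V_N(\mathbb{R}^k)$, and in every degree they induce isomorphisms $$\varinjlim_{k\in\mathbb{N}}H_*(X_{(k)})\xrightarrow{\ \cong\ }H_*^G(X)\qquad\text{and}\qquad H^*_G(X)\xrightarrow{\ \cong\ }\varprojlim_{k\in\mathbb{N}}H^*(X_{(k)}).$$ -/

import Mathlib

open CategoryTheory CategoryTheory.Limits Opposite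

noncomputable section

namespace BorelStiefel

/-! ### Singular homology and cohomology with coefficients in `ℤ/2` -/

/-- Singular homology `H_q( · ; ℤ/2)` as a covariant functor. -/
abbrev singularHomology (q : ℕ) : TopCat.{0} ⥤ ModuleCat.{0} (ZMod 2) :=
  (AlgebraicTopology.singularHomologyFunctor (ModuleCat.{0} (ZMod 2)) q).obj
    (ModuleCat.of (ZMod 2) (ZMod 2))

/-- The singular chain complex with coefficients in `ℤ/2`. -/
abbrev singularChains : TopCat.{0} ⥤ ChainComplex (ModuleCat.{0} (ZMod 2)) ℕ :=
  (AlgebraicTopology.singularChainComplexFunctor (ModuleCat.{0} (ZMod 2))).obj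
    (ModuleCat.of (ZMod 2) (ZMod 2))

/-- The singular cochain complex `Hom(C_*( · ; ℤ/2), ℤ/2)`, contravariant in the space. -/
def singularCochains :
    TopCat.{0}ᵒᵖ ⥤ HomologicalComplex (ModuleCat.{0} (ZMod 2)) (ComplexShape.down ℕ).symm :=
  singularChains.op ⋙ HomologicalComplex.opFunctor _ _ ⋙
    ((linearYoneda (ZMod 2) (ModuleCat.{0} (ZMod 2))).obj
      (ModuleCat.of (ZMod 2) (ZMod 2))).mapHomologicalComplex _

/-- Singular cohomology `H^q( · ; ℤ/2)` as a contravariant functor. -/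
def singularCohomology (q : ℕ) : TopCat.{0}ᵒᵖ ⥤ ModuleCat.{0} (ZMod 2) :=
  singularCochains ⋙ HomologicalComplex.homologyFunctor _ _ q

/-! ### Arc-symmetric sets, `AS`-sets and `G`-`AS`-sets -/

/-- Semialgebraic subsets of `ℝ^d`: Boolean combinations of sets `{f > 0}`, `f` a polynomial. -/
def IsSemialgebraic {d : ℕ} (A : Set (Fin d → ℝ)) : Prop :=
  A ∈ BooleanSubalgebra.closure
    {S : Set (Fin d → ℝ) | ∃ f : MvPolynomial (Fin d) ℝ, S = {x | 0 < MvPolynomial.eval x f}}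

/-- Arc-symmetric subsets of `ℝ^d`: semialgebraic sets `A` such that every real analytic arc on
`(-1, 1)` that maps `(-1, 0)` into `A` maps all of `(-1, 1)` into `A`. -/
def IsArcSymmetric {d : ℕ} (A : Set (Fin d → ℝ)) : Prop :=
  IsSemialgebraic A ∧
    ∀ γ : ℝ → Fin d → ℝ, AnalyticOnNhd ℝ γ (Set.Ioo (-1) 1) →
      Set.MapsTo γ (Set.Ioo (-1) 0) A → Set.MapsTo γ (Set.Ioo (-1) 1) A

/-- Boolean combinations of compact arc-symmetric subsets of `ℝ^d`. Among the sets with compact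
Zariski closure, these are the subsets of `ℝ^d` that are Boolean combinations of arc-symmetric
subsets of the projective space. -/
def IsAS {d : ℕ} (A : Set (Fin d → ℝ)) : Prop :=
  A ∈ BooleanSubalgebra.closure {S : Set (Fin d → ℝ) | IsCompact S ∧ IsArcSymmetric S}

/-- The (real) Zariski closure of a subset of `ℝ^d`. -/
def zariskiClosure {d : ℕ} (A : Set (Fin d → ℝ)) : Set (Fin d → ℝ) :=
  MvPolynomial.zeroLocus ℝ (MvPolynomial.vanishingIdeal ℝ A)

/-- A `G`-`AS`-set in its linear affine form: an `AS`-subset of `ℝ^d` with compact Zariski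
closure, together with a linear action of `G` on `ℝ^d` that maps it into itself. -/
structure GASSet (G : Type*) [Group G] (d : ℕ) where
  rep : Representation ℝ G (Fin d → ℝ)
  carrier : Set (Fin d → ℝ)
  isAS : IsAS carrier
  isCompact_zariskiClosure : IsCompact (zariskiClosure carrier)
  stable : ∀ (g : G) (x : Fin d → ℝ), x ∈ carrier → rep g x ∈ carrier

instance {G : Type*} [Group G] {d : ℕ} (X : GASSet G d) : MulAction G X.carrier where
  smul g x := ⟨X.rep g x.1, X.stable g x.1 x.2⟩
  one_smul x := Subtype.ext (by change X.rep 1 x.1 = x.1; simp)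
  mul_smul g h x := Subtype.ext (by
    change X.rep (g * h) x.1 = X.rep g (X.rep h x.1); simp)

/-! ### Stiefel manifolds -/

/-- `V_n(ℝ^k)`: orthonormal `n`-frames of `ℝ^k`, topologized as a subset of `(ℝ^k)^n`. -/
abbrev Stiefel (n k : ℕ) : Type :=
  {v : Fin n → Fin k → ℝ // ∀ i j, v i ⬝ᵥ v j = if i = j then 1 else 0}

/-- `V_n(ℝ^∞)`: orthonormal `n`-frames in the space of finitely supported real sequences. -/
def StiefelInf (n : ℕ) : Type :=
  {v : Fin n → ℕ →₀ ℝ // ∀ i j, (v i).sum (fun l a => a * v j l) = if i = j then 1 else 0}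

/-- The inclusion `V_n(ℝ^k) → V_n(ℝ^∞)`, extending vectors by zero. -/
def Stiefel.toInf {n k : ℕ} (v : Stiefel n k) : StiefelInf n :=
  ⟨fun i => Finsupp.embDomain Fin.valEmbedding (Finsupp.equivFunOnFinite.symm (v.1 i)), by
    intro i j
    rw [Finsupp.sum_embDomain, ← v.2 i j, Finsupp.sum_fintype _ _ (by simp)]
    simp only [dotProduct, Finsupp.embDomain_apply_self, Finsupp.equivFunOnFinite_symm_apply_apply]⟩

/-- `V_n(ℝ^∞)` carries the inductive limit topology of the `V_n(ℝ^k)`. -/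
instance (n : ℕ) : TopologicalSpace (StiefelInf n) :=
  ⨆ k : ℕ, TopologicalSpace.coinduced (Stiefel.toInf (n := n) (k := k)) inferInstance

/-- An action of `G` on `{1, …, n}` by permutations acts on frames by permuting their vectors:
`g • A = A M_g⁻¹`, where `M_g` is the permutation matrix of `g`. -/
instance {G : Type*} [Group G] (n : ℕ) [MulAction G (Fin n)] : MulAction G (StiefelInf n) where
  smul g v := ⟨fun j => v.1 (g⁻¹ • j), fun i j => by simp [v.2]⟩
  one_smul v := Subtype.ext (by
    change (fun j => v.1 ((1 : G)⁻¹ • j)) = v.1; simp)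
  mul_smul g h v := Subtype.ext (by
    change (fun j => v.1 ((g * h)⁻¹ • j)) = fun j => v.1 (h⁻¹ • g⁻¹ • j); simp [mul_smul])

/-! ### The Borel construction -/

/-- `X ×_G E`: the topological quotient of `X × E` by the diagonal action of `G`. -/
abbrev BorelConstruction (G X E : Type*) [Group G] [MulAction G X] [MulAction G E] : Type _ :=
  MulAction.orbitRel.Quotient G (X × E)

/-- The homotopy quotient `X ×_G V_N(ℝ^∞)` of a `G`-`AS`-set, where `N = |G|`. -/
abbrev homotopyQuotient {G : Type*} [Group G] [MulAction G (Fin (Nat.card G))] {d : ℕ}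
    (X : GASSet G d) : TopCat.{0} :=
  TopCat.of (BorelConstruction G X.carrier (StiefelInf (Nat.card G)))

/-- Equivariant singular homology `H_q^G(X) = H_q(X ×_G E_G ; ℤ/2)`, with `E_G = V_N(ℝ^∞)`. -/
abbrev equivariantHomology {G : Type*} [Group G] [MulAction G (Fin (Nat.card G))] {d : ℕ}
    (X : GASSet G d) (q : ℕ) : ModuleCat.{0} (ZMod 2) :=
  (singularHomology q).obj (homotopyQuotient X)

/-- Equivariant singular cohomology `H^q_G(X) = H^q(X ×_G E_G ; ℤ/2)`, with `E_G = V_N(ℝ^∞)`. -/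
abbrev equivariantCohomology {G : Type*} [Group G] [MulAction G (Fin (Nat.card G))] {d : ℕ}
    (X : GASSet G d) (q : ℕ) : ModuleCat.{0} (ZMod 2) :=
  (singularCohomology q).obj (op (homotopyQuotient X))

/-! ### The geometric quotients -/

/-- Indices of the coordinates of `ℝ^d × (ℝ^n)^k`. -/
abbrev Coord (d n k : ℕ) : Type := Fin d ⊕ Fin k × Fin n

/-- The point of `ℝ^d × (ℝ^n)^k` given by `x ∈ ℝ^d` and the `k × n` matrix with columns `v`. -/
def coords {d n k : ℕ} (x : Fin d → ℝ) (v : Fin n → Fin k → ℝ) : Coord d n k → ℝ :=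
  Sum.elim x (fun q => v q.2 q.1)

/-- The inclusion `ℝ^d × (ℝ^n)^k → ℝ^d × (ℝ^n)^(k+1)`, setting the new coordinates to zero. -/
def extendZero {d n k : ℕ} (w : Coord d n k → ℝ) : Coord d n (k + 1) → ℝ :=
  Sum.elim (fun i => w (Sum.inl i))
    (fun q => Fin.lastCases (motive := fun _ => ℝ) 0 (fun l => w (Sum.inr (l, q.2))) q.1)

/-- The inclusion of the coordinates of level `k` into those of level `k + 1`. -/
def coordSucc {d n k : ℕ} : Coord d n k → Coord d n (k + 1) :=
  Sum.map id (Prod.map Fin.castSucc id)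

lemma extendZero_comp_coordSucc {d n k : ℕ} (w : Coord d n k → ℝ) :
    extendZero w ∘ coordSucc = w := by
  funext c
  rcases c with i | ⟨l, j⟩ <;> simp [extendZero, coordSucc]

section Invariants

variable {G : Type*} [Group G] {d : ℕ} (ρ : Representation ℝ G (Fin d → ℝ)) (n : ℕ)
  [MulAction G (Fin n)]

/-- The diagonal linear action of `G` on `ℝ^d × (ℝ^n)^k`. -/
def diagAct {k : ℕ} (g : G) (w : Coord d n k → ℝ) : Coord d n k → ℝ :=
  Sum.elim (ρ g (fun i => w (Sum.inl i))) (fun q => w (Sum.inr (q.1, g⁻¹ • q.2)))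

/-- The algebra of invariant polynomials on `ℝ^d × (ℝ^n)^k`. -/
def invariants (k : ℕ) : Subalgebra ℝ (MvPolynomial (Coord d n k) ℝ) where
  carrier := {f | ∀ (g : G) (w : Coord d n k → ℝ),
    MvPolynomial.eval (diagAct ρ n g w) f = MvPolynomial.eval w f}
  mul_mem' ha hb g w := by simp [ha g w, hb g w]
  add_mem' ha hb g w := by simp [ha g w, hb g w]
  algebraMap_mem' r g w := by simp

/-- A compatible choice of finite families of generators of the invariant algebras: the generators
at level `k + 1` are those of level `k`, followed by polynomials that vanish on
`ℝ^d × (ℝ^n)^k`. -/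
structure CompatibleGenerators where
  m : ℕ → ℕ
  p : ∀ k, Fin (m k) → MvPolynomial (Coord d n k) ℝ
  adjoin_eq : ∀ k, Algebra.adjoin ℝ (Set.range (p k)) = invariants ρ n k
  m_le : ∀ k, m k ≤ m (k + 1)
  p_succ : ∀ (k : ℕ) (i : Fin (m k)),
    p (k + 1) (Fin.castLE (m_le k) i) = MvPolynomial.rename coordSucc (p k i)
  p_vanish : ∀ (k : ℕ) (j : Fin (m (k + 1))), m k ≤ j.1 →
    ∀ w : Coord d n k → ℝ, MvPolynomial.eval (extendZero w) (p (k + 1) j) = 0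

end Invariants

/-! ### Existence of compatible generators -/

section Existence

open MvPolynomial

variable {G : Type*} [Group G] {d : ℕ} (ρ : Representation ℝ G (Fin d → ℝ)) (n : ℕ)
  [MulAction G (Fin n)]

lemma diagAct_add {k} (g : G) (w w' : Coord d n k → ℝ) :
    diagAct ρ n g (w + w') = diagAct ρ n g w + diagAct ρ n g w' := by
  funext c; rcases c with i | q
  · exact congrFun (map_add (ρ g) (fun i => w (Sum.inl i)) fun i => w' (Sum.inl i)) i
  · simp [diagAct]

lemma diagAct_smul {k} (g : G) (r : ℝ) (w : Coord d n k → ℝ) :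
    diagAct ρ n g (r • w) = r • diagAct ρ n g w := by
  funext c; rcases c with i | q
  · exact congrFun (map_smul (ρ g) r fun i => w (Sum.inl i)) i
  · simp [diagAct]

lemma diagAct_mul {k} (g h : G) (w : Coord d n k → ℝ) :
    diagAct ρ n (g * h) w = diagAct ρ n g (diagAct ρ n h w) := by
  funext c; rcases c with i | q
  · simp [diagAct]
  · simp [diagAct, mul_smul]

lemma diagAct_one {k} (w : Coord d n k → ℝ) :
    diagAct ρ n (1 : G) w = w := by
  funext c; rcases c with i | q <;> simp [diagAct]

def diagLin (k) (g : G) : (Coord d n k → ℝ) →ₗ[ℝ] (Coord d n k → ℝ) where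
  toFun := diagAct ρ n g
  map_add' := diagAct_add ρ n g
  map_smul' := diagAct_smul ρ n g

/-- Composition of a polynomial with the linear action of `g`. -/
def actSubst (k) (g : G) : MvPolynomial (Coord d n k) ℝ →ₐ[ℝ] MvPolynomial (Coord d n k) ℝ :=
  aeval (fun c => ∑ c', MvPolynomial.C (diagAct ρ n g (Pi.single c' 1) c) * X c')

lemma eval_actSubst (k) (g : G) (w : Coord d n k → ℝ) (f) :
    eval w (actSubst ρ n k g f) = eval (diagAct ρ n g w) f := by
  have : (eval w).comp (actSubst ρ n k g : _ →+* _) = eval (diagAct ρ n g w) := by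
    apply MvPolynomial.ringHom_ext
    · intro r; simp [actSubst]
    · intro c
      simp only [actSubst, RingHom.comp_apply, RingHom.coe_coe, aeval_X, map_sum, map_mul, eval_C, eval_X]
      have h := congrFun (congrArg (diagLin ρ n k g) (pi_eq_sum_univ' w)) c
      rw [map_sum] at h
      simp only [map_smul, Finset.sum_apply, Pi.smul_apply, smul_eq_mul] at h
      change diagAct ρ n g w c = _ at h
      rw [h]
      refine Finset.sum_congr rfl fun c' _ => ?_
      exact mul_comm _ _
  exact congrArg (fun φ : _ →+* ℝ => φ f) this

theorem inv_fg [Finite G] (k : ℕ) : (invariants ρ n k).FG := by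
  let R := MvPolynomial (Coord d n k) ℝ
  let _ : MulSemiringAction G R :=
    { smul := fun g f => actSubst ρ n k g⁻¹ f
      one_smul := fun f => by
        change actSubst ρ n k (1:G)⁻¹ f = f
        apply MvPolynomial.funext; intro w; rw [eval_actSubst, inv_one, diagAct_one]
      mul_smul := fun g h f => by
        change actSubst ρ n k (g*h)⁻¹ f = actSubst ρ n k g⁻¹ (actSubst ρ n k h⁻¹ f)
        apply MvPolynomial.funext; intro w; rw [eval_actSubst, eval_actSubst, eval_actSubst, mul_inv_rev, diagAct_mul]
      smul_zero := fun g => map_zero _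
      smul_add := fun g => map_add _
      smul_one := fun g => map_one _
      smul_mul := fun g => map_mul _ }
  have key : ∀ (g : G) (f : R), g • f = actSubst ρ n k g⁻¹ f := fun _ _ => rfl
  have : Algebra.IsInvariant (invariants ρ n k) R G := ⟨fun b hb => ⟨⟨b, fun g w => by
    rw [← eval_actSubst, ← inv_inv g, ← key, hb]⟩, rfl⟩⟩
  have : SMulCommClass G (invariants ρ n k) R := ⟨fun g a f => by
    rw [Algebra.smul_def, Algebra.smul_def, smul_mul']
    congr 1
    apply MvPolynomial.funext; intro w
    rw [key, eval_actSubst]; exact a.2 _ _⟩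
  have : Algebra.IsIntegral (invariants ρ n k) R := Algebra.IsInvariant.isIntegral _ _ G
  have : Algebra.FiniteType (invariants ρ n k) R :=
    Algebra.FiniteType.of_restrictScalars_finiteType ℝ _ _
  have : Module.Finite (invariants ρ n k) R := Algebra.IsIntegral.finite
  rw [← Subalgebra.fg_top]
  exact fg_of_fg_of_fg ℝ (invariants ρ n k) R Algebra.FiniteType.out Module.Finite.fg_top
    Subtype.val_injective

/-- Setting the coordinates that are new at level `k + 1` to zero in a polynomial. -/
def res (k) : MvPolynomial (Coord d n (k+1)) ℝ →ₐ[ℝ] MvPolynomial (Coord d n k) ℝ :=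
  aeval (Sum.elim (fun i => X (Sum.inl i))
    (fun q => Fin.lastCases (motive := fun _ => MvPolynomial (Coord d n k) ℝ) 0 (fun l => X (Sum.inr (l, q.2))) q.1))

lemma eval_res (k) (w : Coord d n k → ℝ) (f) :
    eval w (res n k f) = eval (extendZero w) f := by
  have : (eval w).comp (res (d := d) n k : _ →+* _) = eval (extendZero w) := by
    apply MvPolynomial.ringHom_ext
    · intro r; simp [res]
    · rintro (i | ⟨l, j⟩)
      · simp [res, extendZero]
      · refine Fin.lastCases ?_ (fun l => ?_) l <;> simp [res, extendZero]
  exact congrArg (fun φ : _ →+* ℝ => φ f) this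

lemma diagAct_extendZero {k} (g : G) (w : Coord d n k → ℝ) :
    diagAct ρ n g (extendZero w) = extendZero (diagAct ρ n g w) := by
  funext c
  rcases c with i | ⟨l, j⟩
  · rfl
  · refine Fin.lastCases ?_ (fun l => ?_) l <;> simp [diagAct, extendZero]

lemma diagAct_coordSucc {k} (g : G) (w : Coord d n (k+1) → ℝ) :
    diagAct ρ n g w ∘ coordSucc = diagAct ρ n g (w ∘ coordSucc) := by
  funext c
  rcases c with i | ⟨l, j⟩
  · rfl
  · simp [diagAct, coordSucc]

lemma res_mem (k) {f} (hf : f ∈ invariants ρ n (k+1)) : res n k f ∈ invariants ρ n k := by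
  intro g w
  rw [eval_res, eval_res, ← diagAct_extendZero]; exact hf _ _

lemma rename_mem (k) {f} (hf : f ∈ invariants ρ n k) :
    rename coordSucc f ∈ invariants ρ n (k+1) := by
  intro g w
  rw [eval_rename, eval_rename, diagAct_coordSucc]; exact hf _ _

/-- Finite generation of the invariant algebras. -/
lemma exists_gens [Finite G] (k) : ∃ (m : ℕ) (p : Fin m → MvPolynomial (Coord d n k) ℝ),
    Algebra.adjoin ℝ (Set.range p) = invariants ρ n k := by
  obtain ⟨s, hs⟩ := inv_fg ρ n k
  exact ⟨s.card, fun i => (s.equivFin.symm i).1, by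
    rw [← hs]; congr 1; ext x; constructor
    · rintro ⟨i, rfl⟩; exact (s.equivFin.symm i).2
    · intro hx; exact ⟨s.equivFin ⟨x, hx⟩, by simp⟩⟩

/-- Finite families of generators at level `k`. -/
abbrev Gen (k) := {P : Σ m : ℕ, Fin m → MvPolynomial (Coord d n k) ℝ //
    Algebra.adjoin ℝ (Set.range P.2) = invariants ρ n k}

lemma exists_step [Finite G] (k) (P : Gen ρ n k) : ∃ Q : Gen ρ n (k+1), ∃ h : P.1.1 ≤ Q.1.1,
    (∀ i, Q.1.2 (Fin.castLE h i) = rename coordSucc (P.1.2 i)) ∧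
    ∀ j : Fin Q.1.1, P.1.1 ≤ j.1 → ∀ w : Coord d n k → ℝ, eval (extendZero w) (Q.1.2 j) = 0 := by
  obtain ⟨r, q, hq⟩ := exists_gens ρ n (k+1)
  obtain ⟨⟨m, p⟩, hp⟩ := P
  dsimp only at hp ⊢
  have hpm : ∀ i, p i ∈ invariants ρ n k := fun i => hp ▸ Algebra.subset_adjoin ⟨i, rfl⟩
  have hqm : ∀ i, q i ∈ invariants ρ n (k+1) := fun i => hq ▸ Algebra.subset_adjoin ⟨i, rfl⟩
  let Q : Fin (m + r) → MvPolynomial (Coord d n (k+1)) ℝ :=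
    Fin.append (fun i => rename coordSucc (p i)) (fun j => q j - rename coordSucc (res n k (q j)))
  refine ⟨⟨⟨m + r, Q⟩, ?_⟩, Nat.le_add_right m r, ?_, ?_⟩
  · have hsub : ∀ f ∈ invariants ρ n k, rename coordSucc f ∈ Algebra.adjoin ℝ (Set.range Q) := by
      intro f hf
      rw [← hp] at hf
      have : rename coordSucc f ∈ (Algebra.adjoin ℝ (Set.range p)).map
        (rename (R := ℝ) (coordSucc (d := d) (n := n) (k := k))) := ⟨f, hf, rfl⟩
      rw [AlgHom.map_adjoin] at this
      refine Algebra.adjoin_mono ?_ this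
      rintro _ ⟨_, ⟨i, rfl⟩, rfl⟩
      exact ⟨Fin.castAdd r i, by simp [Q]⟩
    apply le_antisymm
    · apply Algebra.adjoin_le
      rintro _ ⟨i, rfl⟩
      refine Fin.addCases (fun i => ?_) (fun j => ?_) i
      · simp only [Q, Fin.append_left]; exact rename_mem ρ n k (hpm i)
      · simp only [Q, Fin.append_right]
        exact sub_mem (hqm j) (rename_mem ρ n k (res_mem ρ n k (hqm j)))
    · rw [← hq]
      apply Algebra.adjoin_le
      rintro _ ⟨j, rfl⟩
      have h1 : Q (Fin.natAdd m j) ∈ Algebra.adjoin ℝ (Set.range Q) :=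
        Algebra.subset_adjoin ⟨_, rfl⟩
      have h2 := add_mem h1 (hsub _ (res_mem ρ n k (hqm j)))
      simpa [Q] using h2
  · intro i
    exact Fin.append_left (fun i => rename coordSucc (p i)) (fun j => q j - rename coordSucc (res n k (q j))) i
  · intro j hj w
    obtain ⟨j', rfl⟩ : ∃ j', j = Fin.natAdd m j' := ⟨⟨j.1 - m, by have := j.2; dsimp only at this hj; omega⟩, by
      ext; simp only [Fin.natAdd]; dsimp only at hj; omega⟩
    simp only [Q, Fin.append_right, map_sub, eval_rename, extendZero_comp_coordSucc, eval_res, sub_self]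

/-- Compatible families of generators exist. -/
theorem CompatibleGenerators.nonempty [Finite G] : Nonempty (CompatibleGenerators ρ n) := by
  obtain ⟨m0, p0, h0⟩ := exists_gens ρ n 0
  choose F hF h1 h2 using exists_step ρ n
  let S : ∀ k, Gen ρ n k := fun k => Nat.rec ⟨⟨m0, p0⟩, h0⟩ (fun k P => F k P) k
  exact ⟨{ m := fun k => (S k).1.1, p := fun k => (S k).1.2, adjoin_eq := fun k => (S k).2
           m_le := fun k => hF k (S k)
           p_succ := fun k => h1 k (S k)
           p_vanish := fun k => h2 k (S k) }⟩

end Existence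

section GeometricQuotient

variable {G : Type*} [Group G] {d : ℕ} (X : GASSet G d) {n : ℕ} [MulAction G (Fin n)]
  (P : CompatibleGenerators X.rep n)

/-- `π_k = (p_1, …, p_{m_k})` on `X × V_n(ℝ^k)`. -/
def quotientMap (k : ℕ) (z : X.carrier × Stiefel n k) : Fin (P.m k) → ℝ :=
  fun i => MvPolynomial.eval (coords z.1.1 z.2.1) (P.p k i)

/-- `X_(k) = π_k(X × V_n(ℝ^k)) ⊆ ℝ^(m_k)`. -/
abbrev geometricQuotient (k : ℕ) : Set (Fin (P.m k) → ℝ) := Set.range (quotientMap X P k)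

/-- The inclusion `ℝ^(m_k) → ℝ^(m_{k+1})`, `y ↦ (y, 0)`. -/
def appendZero {m m' : ℕ} (y : Fin m → ℝ) : Fin m' → ℝ :=
  fun j => if h : j.1 < m then y ⟨j.1, h⟩ else 0

/-- The inclusion `V_n(ℝ^k) → V_n(ℝ^(k+1))`. -/
def Stiefel.succ {n k : ℕ} (v : Stiefel n k) : Stiefel n (k + 1) :=
  ⟨fun i => Fin.snoc (α := fun _ => ℝ) (v.1 i) 0, fun i j => by
    rw [← v.2 i j]; simp [dotProduct, Fin.sum_univ_castSucc]⟩

lemma coords_succ {k : ℕ} (x : Fin d → ℝ) (v : Stiefel n k) :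
    coords x v.succ.1 = extendZero (coords x v.1) := by
  funext c
  rcases c with i | ⟨l, j⟩
  · rfl
  · refine Fin.lastCases ?_ (fun l => ?_) l <;> simp [coords, extendZero, Stiefel.succ]

lemma appendZero_quotientMap (k : ℕ) (z : X.carrier × Stiefel n k) :
    appendZero (quotientMap X P k z) = quotientMap X P (k + 1) (z.1, z.2.succ) := by
  funext j
  simp only [appendZero, quotientMap, coords_succ]
  split_ifs with h
  · have := P.p_succ k ⟨j.1, h⟩
    rw [show Fin.castLE (P.m_le k) ⟨j.1, h⟩ = j from rfl] at this
    rw [this, MvPolynomial.eval_rename, extendZero_comp_coordSucc]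
  · exact (P.p_vanish k j (not_lt.mp h) _).symm

/-- The inclusion `X_(k) → X_(k+1)`, the restriction of `y ↦ (y, 0)`. -/
def geometricQuotientIncl (k : ℕ) :
    C(geometricQuotient X P k, geometricQuotient X P (k + 1)) where
  toFun y := ⟨appendZero y.1, by
    obtain ⟨_, z, rfl⟩ := y
    exact ⟨_, (appendZero_quotientMap X P k z).symm⟩⟩
  continuous_toFun := by
    refine Continuous.subtype_mk (continuous_pi fun j => ?_) _
    by_cases h : j.1 < P.m k
    · simp only [appendZero, h, dite_true]
      exact (continuous_apply _).comp continuous_subtype_val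
    · simp only [appendZero, h, dite_false]
      exact continuous_const

/-- The inductive system `X_(0) → X_(1) → X_(2) → ⋯` of the inclusions. -/
def geometricQuotientSystem : ℕ ⥤ TopCat.{0} :=
  Functor.ofSequence (X := fun k => TopCat.of (geometricQuotient X P k))
    (fun k => TopCat.ofHom (geometricQuotientIncl X P k))

end GeometricQuotient

end BorelStiefel

end

/-!
The geometric quotient `X_(k)` is the orbit space of `X × V_N(ℝ^k)`. Indeed the generators of the
invariant polynomials define a map `π_k` that separates the orbits of the finite group `G`
(`orbitMap_eq_iff`) and is proper, because `∑ g, ‖g w‖²` is invariant and hence a polynomial in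
`π_k w` (`isProperMap_orbitMap`). So `π_k` restricts to a closed surjection from the stable set
`X × V_N(ℝ^k)` onto `X_(k)`, whether or not `X` is closed, and `[x, v]` depends continuously on
`π_k(x, v)`. The resulting map `ι_k : X_(k) → X ×_G V_N(ℝ^∞)` is a closed embedding
(`isClosedEmbedding_geometricQuotientToBorel`), because `V_N(ℝ^k) → V_N(ℝ^∞)` is one and orbit maps
of finite groups are closed.

The space `X ×_G V_N(ℝ^∞)` need not carry the inductive limit topology of the `X_(k)`, since `X`
need not be locally compact. However, each of its compact subsets lies in some `X_(k)`
(`exists_subset_range_toBorel`), and this is all that singular homology sees: every singular simplex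
factors through some `X_(k)`, so the singular chain complex is the increasing union of those of the
`X_(k)`, and its homology is the colimit of their homologies (`isColimitMapSingularHomology`).

Over the field `ℤ/2` cohomology is naturally the dual of homology (`singularCohomologyIso`), and
dualization turns colimits into limits, so no derived limit enters.
-/

noncomputable section

namespace BorelStiefel

/-! ### Homology of a union of chain complexes -/

section Homology

variable {R : Type} [Ring R]

/-- A cocone under a sequence of modules is a colimit as soon as it is jointly surjective and every
element that it kills already vanishes at a later stage. -/
def isColimitOfJointlySurjective {F : ℕ ⥤ ModuleCat.{0} R} (c : Cocone F)
    (hsurj : ∀ x : c.pt, ∃ (k : ℕ) (y : F.obj k), c.ι.app k y = x)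
    (hinj : ∀ (k : ℕ) (y : F.obj k), c.ι.app k y = 0 → ∃ (l : ℕ) (f : k ⟶ l), F.map f y = 0) :
    IsColimit c :=
  isColimitOfReflects (forget _) <| Types.FilteredColimit.isColimitOf' _ _
    (fun x => by
      obtain ⟨k, y, h⟩ := hsurj x
      exact ⟨k, y, h.symm⟩)
    (fun k x y h => by
      obtain ⟨l, f, hf⟩ := hinj k (x - y) (by
        rw [map_sub, sub_eq_zero]
        exact h)
      rw [map_sub, sub_eq_zero] at hf
      exact ⟨l, f, hf⟩)

variable {ι : Type} {s : ComplexShape ι} (K : HomologicalComplex (ModuleCat.{0} R) s)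

lemma exists_iCycles_eq (i : ι) (x : K.X i) (hx : K.d i (s.next i) x = 0) :
    ∃ z : K.cycles i, K.iCycles i z = x := by
  have h := ShortComplex.exact_of_f_is_kernel
    (ShortComplex.mk (K.iCycles i) (K.d i (s.next i)) (K.iCycles_d _ _))
    (K.cyclesIsKernel i _ rfl)
  rw [ShortComplex.moduleCat_exact_iff] at h
  exact h x hx

lemma exists_toCycles_eq (i : ι) (z : K.cycles i) (hz : K.homologyπ i z = 0) :
    ∃ b : K.X (s.prev i), K.toCycles (s.prev i) i b = z := by
  have h := ShortComplex.exact_of_g_is_cokernel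
    (ShortComplex.mk (K.toCycles (s.prev i) i) (K.homologyπ i) (K.toCycles_comp_homologyπ _ _))
    (K.homologyIsCokernel _ i rfl)
  rw [ShortComplex.moduleCat_exact_iff] at h
  exact h z hz

/-- If a chain complex is the increasing union of a sequence of subcomplexes, then its homology is
the colimit of the homologies of these subcomplexes. -/
def isColimitMapHomology {F : ℕ ⥤ HomologicalComplex (ModuleCat.{0} R) s} (c : Cocone F)
    (hmono : ∀ k, Mono (c.ι.app k))
    (hsurj : ∀ (i : ι) (x : c.pt.X i), ∃ (k : ℕ) (y : (F.obj k).X i), (c.ι.app k).f i y = x)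
    (i : ι) :
    IsColimit ((HomologicalComplex.homologyFunctor (ModuleCat.{0} R) s i).mapCocone c) := by
  -- Naming the legs with plain codomain `c.pt` keeps constant functors out of the computations.
  let φ (k : ℕ) : F.obj k ⟶ c.pt := c.ι.app k
  have hw {k l : ℕ} (f : k ⟶ l) : F.map f ≫ φ l = φ k := c.w f
  have hinj : ∀ (k : ℕ) (j : ι), Function.Injective ((φ k).f j) := fun k j =>
    (ModuleCat.mono_iff_injective _).1 (have : Mono (φ k) := hmono k; inferInstance)
  have hi : ∀ L : HomologicalComplex (ModuleCat.{0} R) s, Function.Injective (L.iCycles i) :=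
    fun L => (ModuleCat.mono_iff_injective _).1 inferInstance
  have hπ : ∀ L : HomologicalComplex (ModuleCat.{0} R) s, Function.Surjective (L.homologyπ i) :=
    fun L => (ModuleCat.epi_iff_surjective _).1 inferInstance
  refine isColimitOfJointlySurjective _ (fun x => ?_) (fun k x hx => ?_)
  · obtain ⟨z, rfl⟩ := hπ _ x
    obtain ⟨k, y, hy⟩ := hsurj i (c.pt.iCycles i z)
    change (φ k).f i y = _ at hy
    obtain ⟨w, rfl⟩ := exists_iCycles_eq (F.obj k) i y (hinj k _ (by
      rw [map_zero, ← ConcreteCategory.comp_apply, ← HomologicalComplex.Hom.comm,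
        ConcreteCategory.comp_apply, hy, ← ConcreteCategory.comp_apply,
        HomologicalComplex.iCycles_d]
      rfl))
    refine ⟨k, (F.obj k).homologyπ i w, ?_⟩
    change HomologicalComplex.homologyMap (φ k) i _ = _
    rw [← ConcreteCategory.comp_apply, HomologicalComplex.homologyπ_naturality,
      ConcreteCategory.comp_apply]
    refine congrArg _ (hi _ ?_)
    rw [← hy, ← ConcreteCategory.comp_apply, HomologicalComplex.cyclesMap_i,
      ConcreteCategory.comp_apply]
  · obtain ⟨w, rfl⟩ := hπ _ x
    change HomologicalComplex.homologyMap (φ k) i _ = 0 at hx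
    rw [← ConcreteCategory.comp_apply, HomologicalComplex.homologyπ_naturality,
      ConcreteCategory.comp_apply] at hx
    obtain ⟨b, hb⟩ := exists_toCycles_eq c.pt i _ hx
    obtain ⟨l, y, rfl⟩ := hsurj _ b
    change c.pt.toCycles _ _ ((φ l).f _ y) = _ at hb
    let f : k ⟶ max k l := homOfLE (le_max_left _ _)
    let g : l ⟶ max k l := homOfLE (le_max_right _ _)
    refine ⟨max k l, f, ?_⟩
    change HomologicalComplex.homologyMap (F.map f) i _ = 0
    rw [← ConcreteCategory.comp_apply, HomologicalComplex.homologyπ_naturality,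
      ConcreteCategory.comp_apply]
    have key : HomologicalComplex.cyclesMap (F.map f) i w =
        (F.obj (max k l)).toCycles (s.prev i) i ((F.map g).f _ y) := by
      refine hi _ (hinj (max k l) _ ?_)
      have h1 := congrArg (c.pt.iCycles i) hb
      simp only [← ConcreteCategory.comp_apply, Category.assoc, HomologicalComplex.cyclesMap_i,
        HomologicalComplex.toCycles_i] at h1 ⊢
      rw [← HomologicalComplex.comp_f, hw, ← HomologicalComplex.Hom.comm,
        ← HomologicalComplex.comp_f_assoc, hw]
      exact h1.symm
    rw [key, ← ConcreteCategory.comp_apply, HomologicalComplex.toCycles_comp_homologyπ]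
    rfl

end Homology

/-! ### Cohomology as the dual of homology -/

section Cohomology

variable (k : Type) [Field k]

/-- Over a field, dualization preserves homology, since the field is an injective module. -/
instance preservesHomology_linearYoneda :
    ((linearYoneda k (ModuleCat.{0} k)).obj (ModuleCat.of k k)).PreservesHomology := by
  have : Module.Injective k k := Module.injective_of_isSemisimpleRing k k
  have : Injective (ModuleCat.of k k) := Module.injective_object_of_injective_module k k
  refine Functor.preservesHomology_of_map_exact _ fun S hS => ?_
  rw [← ShortComplex.exact_map_iff_of_faithful _ (forget₂ (ModuleCat.{0} k) Ab)]
  have : (preadditiveYonedaObj (ModuleCat.of k k)).PreservesHomology := inferInstance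
  have h := (hS.map (preadditiveYonedaObj (ModuleCat.of k k))).map (forget₂ _ Ab)
  exact h

instance preservesLimits_linearYoneda (M : ModuleCat.{0} k) :
    PreservesLimits ((linearYoneda k (ModuleCat.{0} k)).obj M) :=
  have : PreservesLimits ((linearYoneda k (ModuleCat.{0} k)).obj M ⋙ forget _) :=
    (inferInstance : PreservesLimits (yoneda.obj M))
  preservesLimits_of_reflects_of_preserves _ (forget _)

/-- An additive functor that preserves homology commutes with the homology of complexes. -/
def mapHomologicalComplexHomologyIso {C D : Type*} [Category* C] [Category* D] [Abelian C]
    [Abelian D] (T : C ⥤ D) [T.Additive] [T.PreservesHomology] {ι : Type*} (s : ComplexShape ι)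
    (i : ι) :
    T.mapHomologicalComplex s ⋙ HomologicalComplex.homologyFunctor D s i ≅
      HomologicalComplex.homologyFunctor C s i ⋙ T :=
  NatIso.ofComponents (fun K => (K.sc i).mapHomologyIso T) (fun f =>
    ShortComplex.mapHomologyIso_hom_naturality
      ((HomologicalComplex.shortComplexFunctor C s i).map f) T)

/-- The universal coefficient theorem over the field `ℤ/2`: cohomology is the dual of homology. -/
def singularCohomologyIso (q : ℕ) :
    singularCohomology q ≅ (singularHomology q).op ⋙
      (linearYoneda (ZMod 2) (ModuleCat.{0} (ZMod 2))).obj (ModuleCat.of (ZMod 2) (ZMod 2)) :=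
  Functor.isoWhiskerLeft (singularChains.op ⋙ HomologicalComplex.opFunctor _ _)
    (mapHomologicalComplexHomologyIso
      ((linearYoneda (ZMod 2) (ModuleCat.{0} (ZMod 2))).obj (ModuleCat.of (ZMod 2) (ZMod 2)))
      (ComplexShape.down ℕ).symm q) ≪≫
  Functor.isoWhiskerLeft singularChains.op (Functor.isoWhiskerRight
    (HomologicalComplex.homologyOpNatIso (ModuleCat.{0} (ZMod 2)) (ComplexShape.down ℕ) q)
      ((linearYoneda (ZMod 2) (ModuleCat.{0} (ZMod 2))).obj (ModuleCat.of (ZMod 2) (ZMod 2))))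

/-- Cohomology takes to limits those cocones of spaces that homology takes to colimits. -/
def isLimitMapCohomology {J : Type} [SmallCategory J] {F : J ⥤ TopCat.{0}} (c : Cocone F) (q : ℕ)
    (hc : IsColimit ((singularHomology q).mapCocone c)) :
    IsLimit ((singularCohomology q).mapCone c.op) :=
  (IsLimit.mapConeEquiv (singularCohomologyIso q).symm (isLimitOfPreserves
    ((linearYoneda (ZMod 2) (ModuleCat.{0} (ZMod 2))).obj (ModuleCat.of (ZMod 2) (ZMod 2))) hc.op))

end Cohomology

/-! ### Singular homology and cohomology of compactly exhausted spaces -/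

section Exhaustion

open scoped Simplicial

/-- The continuous map underlying a singular simplex. -/
def simplexMap {Z : TopCat.{0}} {n : ℕ} (σ : (TopCat.toSSet.obj Z) _⦋n⦌) :
    C(SimplexCategory.toTop.{0}.obj ⦋n⦌, Z) :=
  TopCat.Hom.hom σ.down

/-- A singular simplex whose image lies in the range of an embedding lifts along it. -/
lemma exists_toSSet_map_eq {Y Z : TopCat.{0}} (f : Y ⟶ Z) (hf : Topology.IsEmbedding f) (n : ℕ)
    (σ : (TopCat.toSSet.obj Z) _⦋n⦌) (hσ : Set.range (simplexMap σ) ⊆ Set.range f) :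
    ∃ τ : (TopCat.toSSet.obj Y) _⦋n⦌, (TopCat.toSSet.map f).app _ τ = σ := by
  choose u hu using fun t => hσ (Set.mem_range_self t)
  have hc : Continuous u := hf.continuous_iff.2 (by
    rw [show ⇑f ∘ u = ⇑(simplexMap σ) from funext hu]
    exact (simplexMap σ).continuous)
  refine ⟨⟨TopCat.ofHom ⟨u, hc⟩⟩, ?_⟩
  refine ULift.ext _ _ (TopCat.hom_ext (ContinuousMap.ext fun t => ?_))
  exact hu t

/-- The elementary chains span the simplicial chains. -/
lemma eq_top_of_forall_ιChainComplex_mem {R : Type} [Ring R] {M : ModuleCat.{0} R} {Z : SSet.{0}}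
    {n : ℕ} (S : Submodule R ((Z.chainComplex M).X n))
    (h : ∀ (σ : Z _⦋n⦌) (r : M), Z.ιChainComplex (R := M) σ r ∈ S) : S = ⊤ := by
  rw [← Submodule.ker_mkQ S, LinearMap.ker_eq_top]
  refine congrArg ModuleCat.Hom.hom (?_ : ModuleCat.ofHom S.mkQ = 0)
  refine SSet.chainComplex_hom_ext fun σ => ?_
  rw [comp_zero]
  ext r
  exact (Submodule.Quotient.mk_eq_zero _).2 (h σ r)

variable {F : ℕ ⥤ TopCat.{0}} (c : Cocone F) (hemb : ∀ k, Topology.IsEmbedding (c.ι.app k))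
  (hcpt : ∀ K : Set c.pt, IsCompact K → ∃ k, K ⊆ Set.range (c.ι.app k))

include hemb hcpt

/-- In a compactly exhausted space, each singular chain involves finitely many simplices, and is
therefore a chain of some stage of the exhaustion. -/
lemma singularChains_jointlySurjective (n : ℕ) (x : (singularChains.obj c.pt).X n) :
    ∃ (k : ℕ) (y : (singularChains.obj (F.obj k)).X n),
      (singularChains.map (c.ι.app k)).f n y = x := by
  let φ (k : ℕ) : F.obj k ⟶ c.pt := c.ι.app k
  have hw {k l : ℕ} (f : k ⟶ l) : F.map f ≫ φ l = φ k := c.w f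
  let S (k : ℕ) : Submodule (ZMod 2) ((singularChains.obj c.pt).X n) :=
    LinearMap.range ((singularChains.map (φ k)).f n).hom
  have hS : Monotone S := by
    rintro k l hkl _ ⟨y, rfl⟩
    refine ⟨(singularChains.map (F.map (homOfLE hkl))).f n y, ?_⟩
    rw [← hw (homOfLE hkl), Functor.map_comp]
    rfl
  have htop : ⨆ k, S k = ⊤ := by
    refine eq_top_of_forall_ιChainComplex_mem (Z := TopCat.toSSet.obj c.pt)
      (M := ModuleCat.of (ZMod 2) (ZMod 2)) _ fun σ r => ?_
    obtain ⟨k, hk⟩ := hcpt (Set.range (simplexMap σ)) (by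
      have : CompactSpace (SimplexCategory.toTop.{0}.obj ⦋n⦌) :=
        inferInstanceAs (CompactSpace (ULift (stdSimplex ℝ (Fin (n + 1)))))
      exact isCompact_range (simplexMap σ).continuous)
    obtain ⟨τ, rfl⟩ := exists_toSSet_map_eq (φ k) (hemb k) n σ hk
    refine le_iSup S k ⟨(TopCat.toSSet.obj (F.obj k)).ιChainComplex
      (R := ModuleCat.of (ZMod 2) (ZMod 2)) τ r, ?_⟩
    exact ConcreteCategory.congr_hom (SSet.ι_chainComplexMap_f
      (f := TopCat.toSSet.map (φ k)) (R := ModuleCat.of (ZMod 2) (ZMod 2))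
      (x := τ) ..) r
  obtain ⟨k, y, hy⟩ := (Submodule.mem_iSup_of_directed S hS.directed_le).1
    (htop ▸ Submodule.mem_top : x ∈ ⨆ k, S k)
  exact ⟨k, y, hy⟩

/-- Singular homology takes compact exhaustions by embedded subspaces to colimits. -/
def isColimitMapSingularHomology (q : ℕ) : IsColimit ((singularHomology q).mapCocone c) :=
  isColimitMapHomology (singularChains.mapCocone c)
    (fun k => by
      have : Mono (c.ι.app k) := (TopCat.mono_iff_injective _).2 (hemb k).injective
      change Mono (singularChains.map (c.ι.app k))
      infer_instance)
    (fun n x => singularChains_jointlySurjective c hemb hcpt n x) q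

end Exhaustion

/-! ### Invariant polynomials of a finite group -/

section InvariantTheory

open MvPolynomial

variable {G : Type*} [Group G] {d : ℕ} (ρ : Representation ℝ G (Fin d → ℝ)) (n : ℕ)
  [MulAction G (Fin n)] {k : ℕ}

lemma sum_actSubst_mem_invariants [Fintype G] (f : MvPolynomial (Coord d n k) ℝ) :
    ∑ g : G, actSubst ρ n k g f ∈ invariants ρ n k := fun h w => by
  simp only [map_sum, eval_actSubst, ← diagAct_mul]
  exact Fintype.sum_equiv (Equiv.mulRight h) _ _ fun g => rfl

lemma prod_actSubst_mem_invariants [Fintype G] (f : MvPolynomial (Coord d n k) ℝ) :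
    ∏ g : G, actSubst ρ n k g f ∈ invariants ρ n k := fun h w => by
  simp only [map_prod, eval_actSubst, ← diagAct_mul]
  exact Fintype.prod_equiv (Equiv.mulRight h) _ _ fun g => rfl

/-- Invariant polynomials separate the orbits of a finite group: the product over the group of a
polynomial with zero set the orbit of `w'` is invariant and vanishes at `w` only if `w` lies in
that orbit. -/
lemma exists_diagAct_eq_of_forall_invariants [Finite G] {w w' : Coord d n k → ℝ}
    (h : ∀ f ∈ invariants ρ n k, eval w f = eval w' f) : ∃ g : G, diagAct ρ n g w' = w := by
  have := Fintype.ofFinite G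
  let f : MvPolynomial (Coord d n k) ℝ := ∏ g : G, ∑ c, (X c - C (diagAct ρ n g w' c)) ^ 2
  have hf : ∀ u, eval u f = 0 ↔ ∃ g : G, diagAct ρ n g w' = u := fun u => by
    simp only [f, map_prod, Finset.prod_eq_zero_iff, Finset.mem_univ, true_and, map_sum, map_pow,
      map_sub, eval_X, eval_C]
    refine exists_congr fun g => ?_
    rw [Finset.sum_eq_zero_iff_of_nonneg fun _ _ => sq_nonneg _, funext_iff]
    simp only [Finset.mem_univ, true_imp_iff, sq_eq_zero_iff, sub_eq_zero, eq_comm]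
  have h0 : eval w' (∏ g : G, actSubst ρ n k g f) = 0 := by
    rw [map_prod]
    refine Finset.prod_eq_zero (Finset.mem_univ 1) ?_
    rw [eval_actSubst, hf]
    exact ⟨1, rfl⟩
  rw [← h _ (prod_actSubst_mem_invariants ρ n f), map_prod, Finset.prod_eq_zero_iff] at h0
  obtain ⟨g, -, hg⟩ := h0
  rw [eval_actSubst, hf] at hg
  obtain ⟨a, ha⟩ := hg
  exact ⟨g⁻¹ * a, by rw [diagAct_mul, ha, ← diagAct_mul, inv_mul_cancel, diagAct_one]⟩

variable {ρ n} (P : CompatibleGenerators ρ n)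

/-- The polynomial map `π_k : ℝ^d × (ℝ^n)^k → ℝ^(m_k)` given by the generators. -/
def orbitMap (k : ℕ) (w : Coord d n k → ℝ) : Fin (P.m k) → ℝ := fun i => eval w (P.p k i)

lemma continuous_orbitMap (k : ℕ) : Continuous (orbitMap P k) :=
  continuous_pi fun i => MvPolynomial.continuous_eval (P.p k i)

lemma orbitMap_diagAct (k : ℕ) (g : G) (w : Coord d n k → ℝ) :
    orbitMap P k (diagAct ρ n g w) = orbitMap P k w := by
  funext i
  have h : P.p k i ∈ invariants ρ n k := P.adjoin_eq k ▸ Algebra.subset_adjoin ⟨i, rfl⟩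
  exact h g w

/-- An invariant polynomial is a polynomial function of the generators. -/
lemma exists_eval_eq_eval_orbitMap {f : MvPolynomial (Coord d n k) ℝ} (hf : f ∈ invariants ρ n k) :
    ∃ Q : MvPolynomial (Fin (P.m k)) ℝ, ∀ w, eval w f = eval (orbitMap P k w) Q := by
  rw [← P.adjoin_eq k, Algebra.adjoin_range_eq_range_aeval] at hf
  obtain ⟨Q, rfl⟩ := hf
  refine ⟨Q, fun w => ?_⟩
  change eval w (aeval (P.p k) Q) = _
  rw [← MvPolynomial.coe_aeval_eq_eval, RingHom.coe_coe, ← AlgHom.comp_apply,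
    MvPolynomial.comp_aeval, ← MvPolynomial.coe_aeval_eq_eval, RingHom.coe_coe]
  rfl

lemma orbitMap_eq_iff [Finite G] {w w' : Coord d n k → ℝ} :
    orbitMap P k w = orbitMap P k w' ↔ ∃ g : G, diagAct ρ n g w' = w := by
  constructor
  · intro h
    refine exists_diagAct_eq_of_forall_invariants ρ n fun f hf => ?_
    obtain ⟨Q, hQ⟩ := exists_eval_eq_eval_orbitMap P hf
    rw [hQ, hQ, h]
  · rintro ⟨g, rfl⟩
    exact orbitMap_diagAct P k g w'

/-- The map `π_k` is proper, because the invariant polynomial `∑ g, ‖g w‖²` bounds `‖w‖²` and is a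
polynomial in `π_k w`. -/
lemma isProperMap_orbitMap [Finite G] (k : ℕ) : IsProperMap (orbitMap P k) := by
  have := Fintype.ofFinite G
  refine isProperMap_iff_isCompact_preimage.2 ⟨continuous_orbitMap P k, fun K hK => ?_⟩
  obtain ⟨Q, hQ⟩ := exists_eval_eq_eval_orbitMap P
    (sum_actSubst_mem_invariants ρ n (∑ c : Coord d n k, X c ^ 2))
  obtain ⟨B, hB⟩ := (hK.image (MvPolynomial.continuous_eval Q)).isBounded.bddAbove
  refine Metric.isCompact_of_isClosed_isBounded (hK.isClosed.preimage (continuous_orbitMap P k)) ?_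
  refine (Metric.isBounded_iff_subset_closedBall 0).2 ⟨√B, fun w hw => ?_⟩
  rw [mem_closedBall_zero_iff, pi_norm_le_iff_of_nonneg (Real.sqrt_nonneg _)]
  intro c
  refine Real.abs_le_sqrt (le_trans ?_ (hB ⟨_, hw, rfl⟩))
  beta_reduce
  rw [← hQ, map_sum]
  simp only [eval_actSubst, map_sum, map_pow, eval_X]
  refine le_trans ?_ (Finset.single_le_sum (f := fun g : G => ∑ c, diagAct ρ n g w c ^ 2)
    (fun g _ => Finset.sum_nonneg fun _ _ => sq_nonneg _) (Finset.mem_univ 1))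
  rw [diagAct_one]
  exact Finset.single_le_sum (f := fun c => w c ^ 2) (fun _ _ => sq_nonneg _) (Finset.mem_univ c)

end InvariantTheory

/-! ### Topology of the infinite Stiefel manifold -/

section Stiefel

variable {n : ℕ}

lemma Stiefel.continuous_apply {k : ℕ} (i : Fin n) (l : Fin k) :
    Continuous fun v : Stiefel n k => v.1 i l :=
  (continuous_apply_apply i l).comp continuous_subtype_val

lemma Stiefel.toInf_apply {k : ℕ} (v : Stiefel n k) (i : Fin n) (l : Fin k) :
    v.toInf.1 i l = v.1 i l :=
  Finsupp.embDomain_apply_self Fin.valEmbedding (Finsupp.equivFunOnFinite.symm (v.1 i)) l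

lemma Stiefel.toInf_apply_of_le {k : ℕ} (v : Stiefel n k) (i : Fin n) {l : ℕ} (hl : k ≤ l) :
    v.toInf.1 i l = 0 :=
  Finsupp.embDomain_of_notMem_range _ _ _ (by
    rintro ⟨j, rfl⟩
    exact absurd j.2 (not_lt.2 hl))

/-- A frame comes from `V_n(ℝ^k)` as soon as its coordinates of index at least `k` vanish. -/
lemma StiefelInf.exists_toInf_eq {k : ℕ} (v : StiefelInf n)
    (hv : ∀ (i : Fin n) (l : ℕ), k ≤ l → v.1 i l = 0) : ∃ w : Stiefel n k, w.toInf = v := by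
  refine ⟨⟨fun i l => v.1 i l, fun i j => ?_⟩, Subtype.ext (funext fun i => Finsupp.ext fun l => ?_)⟩
  · rw [← v.2 i j, Finsupp.sum_of_support_subset (s := Finset.range k) _ _ _ (by simp),
      Finset.sum_range]
    · rfl
    · intro l hl
      by_contra h
      exact Finsupp.mem_support_iff.1 hl (hv i l (by simpa using h))
  · rcases lt_or_ge l k with hl | hl
    · exact Stiefel.toInf_apply _ i ⟨l, hl⟩
    · rw [Stiefel.toInf_apply_of_le _ i hl, hv i l hl]

lemma Stiefel.toInf_injective {k : ℕ} : Function.Injective (Stiefel.toInf (n := n) (k := k)) :=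
  fun v w h => Subtype.ext (funext₂ fun i l => by
    rw [← Stiefel.toInf_apply, h, Stiefel.toInf_apply])

lemma Stiefel.toInf_succ {k : ℕ} (v : Stiefel n k) : v.succ.toInf = v.toInf := by
  refine Subtype.ext (funext fun i => Finsupp.ext fun l => ?_)
  rcases lt_trichotomy l k with hl | rfl | hl
  · rw [v.toInf_apply i ⟨l, hl⟩]
    refine (v.succ.toInf_apply i (Fin.castSucc ⟨l, hl⟩)).trans ?_
    exact Fin.snoc_castSucc (α := fun _ => ℝ) _ _ _
  · rw [v.toInf_apply_of_le i le_rfl]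
    refine (v.succ.toInf_apply i (Fin.last l)).trans ?_
    simp [Stiefel.succ]
  · rw [v.toInf_apply_of_le i hl.le, v.succ.toInf_apply_of_le i hl]

lemma StiefelInf.mem_range_toInf_mono {k l : ℕ} (hkl : k ≤ l) {v : StiefelInf n}
    (hv : v ∈ Set.range (Stiefel.toInf (n := n) (k := k))) :
    v ∈ Set.range (Stiefel.toInf (n := n) (k := l)) := by
  obtain ⟨w, rfl⟩ := hv
  exact StiefelInf.exists_toInf_eq _ fun i m hm => w.toInf_apply_of_le i (hkl.trans hm)

lemma StiefelInf.exists_mem_range_toInf (v : StiefelInf n) :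
    ∃ k, v ∈ Set.range (Stiefel.toInf (n := n) (k := k)) := by
  refine ⟨Finset.univ.sup fun i => (v.1 i).support.sup (· + 1),
    StiefelInf.exists_toInf_eq v fun i l hl => ?_⟩
  by_contra h
  have h1 : l + 1 ≤ (v.1 i).support.sup (· + 1) :=
    Finset.le_sup (f := (· + 1)) (Finsupp.mem_support_iff.2 h)
  have h2 : (v.1 i).support.sup (· + 1) ≤
      Finset.univ.sup fun i => (v.1 i).support.sup (· + 1) :=
    Finset.le_sup (f := fun i => (v.1 i).support.sup (· + 1)) (Finset.mem_univ i)
  omega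

lemma StiefelInf.continuous_dom {Y : Type*} [TopologicalSpace Y] {f : StiefelInf n → Y} :
    Continuous f ↔ ∀ k, Continuous fun v : Stiefel n k => f v.toInf := by
  simp only [continuous_iSup_dom, continuous_coinduced_dom]
  rfl

lemma StiefelInf.isClosed_iff {S : Set (StiefelInf n)} :
    IsClosed S ↔ ∀ k, IsClosed ((Stiefel.toInf (n := n) (k := k)) ⁻¹' S) := by
  simp only [isClosed_iSup_iff, isClosed_coinduced]

lemma StiefelInf.continuous_apply (i : Fin n) (l : ℕ) :
    Continuous fun v : StiefelInf n => v.1 i l := by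
  refine StiefelInf.continuous_dom.2 fun k => ?_
  rcases lt_or_ge l k with hl | hl
  · simp only [Stiefel.toInf_apply _ i ⟨l, hl⟩]
    exact Stiefel.continuous_apply i _
  · simp only [Stiefel.toInf_apply_of_le _ i hl]
    exact continuous_const

lemma Stiefel.continuous_toInf {k : ℕ} : Continuous (Stiefel.toInf (n := n) (k := k)) :=
  StiefelInf.continuous_dom.1 continuous_id k

/-- The first `k` coordinates of the vectors of a frame are a continuous left inverse of
`V_n(ℝ^k) → V_n(ℝ^∞)`, and the image is cut out by the vanishing of the other coordinates. -/
lemma Stiefel.isClosedEmbedding_toInf {k : ℕ} :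
    Topology.IsClosedEmbedding (Stiefel.toInf (n := n) (k := k)) := by
  have hr : Continuous fun (v : StiefelInf n) (i : Fin n) (l : Fin k) => v.1 i l :=
    continuous_pi fun i => continuous_pi fun l => StiefelInf.continuous_apply i l
  refine ⟨⟨Topology.IsInducing.of_comp Stiefel.continuous_toInf hr ?_, Stiefel.toInf_injective⟩, ?_⟩
  · have h : (fun (v : StiefelInf n) (i : Fin n) (l : Fin k) => v.1 i l) ∘ Stiefel.toInf =
        (Subtype.val : Stiefel n k → Fin n → Fin k → ℝ) :=
      funext fun v => funext₂ fun i l => v.toInf_apply i l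
    rw [h]
    exact Topology.IsInducing.subtypeVal
  · rw [show Set.range (Stiefel.toInf (n := n) (k := k)) =
        ⋂ (i : Fin n) (l : ℕ) (_ : k ≤ l), {v | v.1 i l = 0} from ?_]
    · exact isClosed_iInter fun i => isClosed_iInter fun l => isClosed_iInter fun _ =>
        isClosed_eq (StiefelInf.continuous_apply i l) continuous_const
    · ext v
      simp only [Set.mem_iInter, Set.mem_ofPred_eq]
      refine ⟨?_, StiefelInf.exists_toInf_eq v⟩
      rintro ⟨w, rfl⟩ i l hl
      exact w.toInf_apply_of_le i hl

variable {G : Type*} [Group G] [MulAction G (Fin n)]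

/-- The action on the frames of `ℝ^k` by permutation of their vectors. -/
instance (k : ℕ) : MulAction G (Stiefel n k) where
  smul g v := ⟨fun j => v.1 (g⁻¹ • j), fun i j => by simp [v.2]⟩
  one_smul v := Subtype.ext (by
    change (fun j => v.1 ((1 : G)⁻¹ • j)) = v.1; simp)
  mul_smul g h v := Subtype.ext (by
    change (fun j => v.1 ((g * h)⁻¹ • j)) = fun j => v.1 (h⁻¹ • g⁻¹ • j); simp [mul_smul])

instance : ContinuousConstSMul G (StiefelInf n) where
  continuous_const_smul g := StiefelInf.continuous_dom.2 fun k => by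
    refine Stiefel.continuous_toInf.comp (g := Stiefel.toInf) (f := fun v : Stiefel n k => g • v) ?_
    exact Continuous.subtype_mk (continuous_pi fun j => continuous_pi fun l =>
      Stiefel.continuous_apply (g⁻¹ • j) l) _

lemma StiefelInf.smul_mem_range_toInf {k : ℕ} (g : G) {v : StiefelInf n}
    (hv : v ∈ Set.range (Stiefel.toInf (n := n) (k := k))) :
    g • v ∈ Set.range (Stiefel.toInf (n := n) (k := k)) := by
  obtain ⟨w, rfl⟩ := hv
  exact ⟨g • w, rfl⟩

end Stiefel

/-! ### The maps from the geometric quotients to the homotopy quotient -/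

section Comparison

variable {G : Type*} [Group G] {d : ℕ} (X : GASSet G d) {n : ℕ}

instance : ContinuousConstSMul G X.carrier where
  continuous_const_smul g := Continuous.subtype_mk
    ((LinearMap.continuous_of_finiteDimensional (X.rep g)).comp continuous_subtype_val) _

lemma coords_injective {k : ℕ} :
    Function.Injective fun z : X.carrier × Stiefel n k => coords z.1.1 z.2.1 := by
  intro z z' h
  refine Prod.ext (Subtype.ext (funext fun i => ?_)) (Subtype.ext (funext₂ fun j l => ?_))
  · exact congrFun h (Sum.inl i)
  · exact congrFun h (Sum.inr (l, j))

lemma isInducing_coords {k : ℕ} :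
    Topology.IsInducing fun z : X.carrier × Stiefel n k => coords z.1.1 z.2.1 := by
  let r : (Coord d n k → ℝ) → (Fin d → ℝ) × (Fin n → Fin k → ℝ) :=
    fun w => (fun i => w (Sum.inl i), fun j l => w (Sum.inr (l, j)))
  refine Topology.IsInducing.of_comp (g := r) (continuous_pi fun c => ?_) (by fun_prop)
    (Topology.IsInducing.prodMap Topology.IsInducing.subtypeVal Topology.IsInducing.subtypeVal)
  rcases c with i | q
  · exact (continuous_apply i).comp (continuous_subtype_val.comp continuous_fst)
  · exact (Stiefel.continuous_apply q.2 q.1).comp continuous_snd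

variable [MulAction G (Fin n)]

lemma coords_smul {k : ℕ} (g : G) (x : X.carrier) (v : Stiefel n k) :
    coords (g • x).1 (g • v).1 = diagAct X.rep n g (coords x.1 v.1) := by
  funext c
  rcases c with i | q <;> rfl

variable (n) in
/-- The map `X × V_n(ℝ^k) → X ×_G V_n(ℝ^∞)`. -/
def toBorel (k : ℕ) (z : X.carrier × Stiefel n k) :
    BorelConstruction G X.carrier (StiefelInf n) :=
  Quotient.mk _ (z.1, z.2.toInf)

lemma toBorel_eq_iff {k : ℕ} {z z' : X.carrier × Stiefel n k} :
    toBorel X n k z = toBorel X n k z' ↔ ∃ g : G, g • z' = z := by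
  refine Quotient.eq.trans (exists_congr fun g => ?_)
  constructor
  · intro h
    exact Prod.ext (congrArg Prod.fst h :) (Stiefel.toInf_injective (congrArg Prod.snd h :))
  · rintro rfl
    rfl

lemma continuous_toBorel (k : ℕ) : Continuous (toBorel X n k) :=
  continuous_quotient_mk'.comp (continuous_id.prodMap Stiefel.continuous_toInf)

lemma isClosedMap_toBorel [Finite G] (k : ℕ) : IsClosedMap (toBorel X n k) := by
  let _ : TopologicalSpace G := ⊥
  have : DiscreteTopology G := ⟨rfl⟩
  have : ContinuousSMul G (X.carrier × StiefelInf n) :=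
    ⟨continuous_prod_of_discrete_left.2 continuous_const_smul⟩
  exact MulAction.isClosedMap_quotient.comp
    (Topology.IsClosedEmbedding.id.prodMap Stiefel.isClosedEmbedding_toInf).isClosedMap

variable (P : CompatibleGenerators X.rep n)

lemma quotientMap_eq_iff [Finite G] {k : ℕ} {z z' : X.carrier × Stiefel n k} :
    quotientMap X P k z = quotientMap X P k z' ↔ ∃ g : G, g • z' = z := by
  refine (orbitMap_eq_iff P).trans (exists_congr fun g => ?_)
  rw [← coords_smul]
  exact (coords_injective X).eq_iff (a := g • z') (b := z)

lemma continuous_quotientMap (k : ℕ) : Continuous (quotientMap X P k) :=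
  (continuous_orbitMap P k).comp (isInducing_coords X).continuous

/-- As `X × V_n(ℝ^k)` is `G`-stable, its closed subsets have relatively closed images under the
proper map `π_k`. Here `X` need not be closed in `ℝ^d`. -/
lemma isClosedMap_rangeFactorization_quotientMap [Finite G] (k : ℕ) :
    IsClosedMap (Set.rangeFactorization (quotientMap X P k)) := by
  intro C hC
  obtain ⟨D, hD, rfl⟩ := (isInducing_coords X).isClosed_iff.1 hC
  convert ((isProperMap_orbitMap P k).isClosedMap D hD).preimage continuous_subtype_val using 1
  ext ⟨_, z, rfl⟩
  constructor
  · rintro ⟨z', hz', h⟩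
    exact ⟨_, hz', congrArg Subtype.val h⟩
  · rintro ⟨w, hw, h⟩
    obtain ⟨g, rfl⟩ := (orbitMap_eq_iff P).1 h
    refine ⟨g • z, ?_, Subtype.ext ((quotientMap_eq_iff X P).2 ⟨g, rfl⟩)⟩
    exact Set.mem_of_eq_of_mem (s := D) (coords_smul X g z.1 z.2) hw

/-- The map `X_(k) → X ×_G V_n(ℝ^∞)` sending `π_k(x, v)` to `[x, v]`. -/
def geometricQuotientToBorel [Finite G] (k : ℕ) :
    C(geometricQuotient X P k, BorelConstruction G X.carrier (StiefelInf n)) :=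
  have h := (isClosedMap_rangeFactorization_quotientMap X P k).isQuotientMap
    ((continuous_quotientMap X P k).subtype_mk _) Set.rangeFactorization_surjective
  h.lift (f := ⟨_, h.continuous⟩) ⟨toBorel X n k, continuous_toBorel X k⟩ fun _ _ hz =>
    (toBorel_eq_iff X).2 ((quotientMap_eq_iff X P).1 (congrArg Subtype.val hz))

lemma geometricQuotientToBorel_apply [Finite G] (k : ℕ) (z : X.carrier × Stiefel n k) :
    geometricQuotientToBorel X P k ⟨quotientMap X P k z, Set.mem_range_self z⟩ =
      toBorel X n k z :=
  have h := (isClosedMap_rangeFactorization_quotientMap X P k).isQuotientMap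
    ((continuous_quotientMap X P k).subtype_mk _) Set.rangeFactorization_surjective
  congrFun (congrArg DFunLike.coe (h.lift_comp (f := ⟨_, h.continuous⟩)
    ⟨toBorel X n k, continuous_toBorel X k⟩ fun _ _ hz =>
      (toBorel_eq_iff X).2 ((quotientMap_eq_iff X P).1 (congrArg Subtype.val hz)))) z

lemma isClosedEmbedding_geometricQuotientToBorel [Finite G] (k : ℕ) :
    Topology.IsClosedEmbedding (geometricQuotientToBorel X P k) := by
  refine .of_continuous_injective_isClosedMap (map_continuous _) ?_ fun C hC => ?_
  · rintro ⟨_, z, rfl⟩ ⟨_, z', rfl⟩ h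
    rw [geometricQuotientToBorel_apply, geometricQuotientToBorel_apply, toBorel_eq_iff] at h
    exact Subtype.ext ((quotientMap_eq_iff X P).2 h)
  · convert isClosedMap_toBorel X k _ (hC.preimage
      ((continuous_quotientMap X P k).subtype_mk Set.mem_range_self)) using 1
    ext y
    constructor
    · rintro ⟨⟨_, z, rfl⟩, hz, rfl⟩
      exact ⟨z, hz, (geometricQuotientToBorel_apply X P k z).symm⟩
    · rintro ⟨z, hz, rfl⟩
      exact ⟨_, hz, geometricQuotientToBorel_apply X P k z⟩

/-- A compact subset of `X ×_G V_n(ℝ^∞)` lies in the image of some `X × V_n(ℝ^k)`. Otherwise it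
contains points `[x_k, v_k]` with `v_k` outside `V_n(ℝ^k)`. The orbits of the `v_k` with `k ≥ m`
form a closed set, since only finitely many of them meet a given `V_n(ℝ^j)`; the complements
of these closed sets are an increasing open cover of which no member contains all `[x_k, v_k]`. -/
lemma exists_subset_range_toBorel [Finite G]
    {K : Set (BorelConstruction G X.carrier (StiefelInf n))} (hK : IsCompact K) :
    ∃ k, K ⊆ Set.range (toBorel X n k) := by
  by_contra! h
  have hex : ∀ k : ℕ, ∃ z : X.carrier × StiefelInf n, (Quotient.mk _ z) ∈ K ∧
      z.2 ∉ Set.range (Stiefel.toInf (n := n) (k := k)) := fun k => by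
    obtain ⟨y, hyK, hy⟩ := Set.not_subset.1 (h k)
    obtain ⟨z, rfl⟩ := Quotient.exists_rep y
    refine ⟨z, hyK, fun ⟨w, hw⟩ => hy ⟨(z.1, w), ?_⟩⟩
    rw [toBorel, hw]
  choose z hzK hz using hex
  let A (m : ℕ) : Set (StiefelInf n) := {v | ∃ k, m ≤ k ∧ ∃ g : G, g • v = (z k).2}
  have hlt : ∀ {j k : ℕ} {g : G} {v : StiefelInf n},
      v ∈ Set.range (Stiefel.toInf (n := n) (k := j)) → g • v = (z k).2 → k < j :=
    fun {j k g v} hv hg => by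
      by_contra! hjk
      exact hz k (StiefelInf.mem_range_toInf_mono hjk (hg ▸ StiefelInf.smul_mem_range_toInf g hv))
  have hA : ∀ m, IsClosed (A m) := fun m => StiefelInf.isClosed_iff.2 fun j => by
    refine Set.Finite.isClosed (((Set.finite_range fun p : Fin j × G =>
      p.2⁻¹ • (z p.1).2).preimage Stiefel.toInf_injective.injOn).subset ?_)
    rintro w ⟨k, -, g, hg⟩
    exact ⟨(⟨k, hlt (Set.mem_range_self w) hg⟩, g), inv_smul_eq_iff.2 hg.symm⟩
  let B (m : ℕ) : Set (BorelConstruction G X.carrier (StiefelInf n)) :=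
    {y | ∃ k, m ≤ k ∧ ∃ x : X.carrier, Quotient.mk _ (x, (z k).2) = y}
  have hB : ∀ m, IsClosed (B m) := fun m => by
    rw [← isQuotientMap_quotient_mk'.isClosed_preimage]
    convert (hA m).preimage (continuous_snd (X := X.carrier)) using 1
    ext ⟨x, v⟩
    constructor
    · rintro ⟨k, hk, x', h⟩
      obtain ⟨g, hg⟩ := Quotient.exact h.symm
      exact ⟨k, hk, g⁻¹, inv_smul_eq_iff.2 (congrArg Prod.snd hg).symm⟩
    · rintro ⟨k, hk, g, hg⟩
      exact ⟨k, hk, g • x, Quotient.sound ⟨g, Prod.ext rfl hg⟩⟩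
  obtain ⟨m, hm⟩ := hK.elim_directed_family_closed B hB (by
    by_contra! hne
    obtain ⟨y, -, hy⟩ := hne
    obtain ⟨⟨x, v⟩, rfl⟩ := Quotient.exists_rep y
    obtain ⟨j, hj⟩ := StiefelInf.exists_mem_range_toInf v
    obtain ⟨k, hk, x', h⟩ := Set.mem_iInter.1 hy j
    obtain ⟨g, hg⟩ := Quotient.exact h.symm
    exact absurd (hlt hj (inv_smul_eq_iff.2 (congrArg Prod.snd hg).symm)) (not_lt.2 hk))
    (directed_of_isDirected_le fun m m' hmm y ⟨k, hk, h⟩ => ⟨k, hmm.trans hk, h⟩)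
  exact (Set.eq_empty_iff_forall_notMem.1 hm) _ ⟨hzK m, m, le_rfl, (z m).1, rfl⟩

end Comparison

/-! ### The cocone of geometric quotients -/

section Cocone

variable {G : Type*} [Group G] {d : ℕ} (X : GASSet G d)

section

variable {n : ℕ} [MulAction G (Fin n)] (P : CompatibleGenerators X.rep n)

lemma geometricQuotientToBorel_incl [Finite G] (k : ℕ) (y : geometricQuotient X P k) :
    geometricQuotientToBorel X P (k + 1) (geometricQuotientIncl X P k y) =
      geometricQuotientToBorel X P k y := by
  obtain ⟨_, z, rfl⟩ := y
  have h : geometricQuotientIncl X P k ⟨quotientMap X P k z, Set.mem_range_self z⟩ =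
      ⟨quotientMap X P (k + 1) (z.1, z.2.succ), Set.mem_range_self _⟩ :=
    Subtype.ext (appendZero_quotientMap X P k z)
  rw [h, geometricQuotientToBorel_apply, geometricQuotientToBorel_apply, toBorel, toBorel,
    Stiefel.toInf_succ]

end

variable [MulAction G (Fin (Nat.card G))] (P : CompatibleGenerators X.rep (Nat.card G))

lemma geometricQuotientSystem_map_succ (k : ℕ) :
    (geometricQuotientSystem X P).map (homOfLE (Nat.le_succ k)) =
      TopCat.ofHom (geometricQuotientIncl X P k) :=
  Functor.ofSequence_map_homOfLE_succ _ k

variable [Finite G]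

/-- The cocone of the geometric quotients with vertex the homotopy quotient. -/
def homotopyQuotientCocone : Cocone (geometricQuotientSystem X P) where
  pt := homotopyQuotient X
  ι := NatTrans.ofSequence (fun k => TopCat.ofHom (geometricQuotientToBorel X P k)) fun k => by
    rw [geometricQuotientSystem_map_succ]
    ext y
    exact geometricQuotientToBorel_incl X P k y

lemma homotopyQuotientCocone_compactlyExhausted
    (K : Set (homotopyQuotientCocone X P).pt) (hK : IsCompact K) :
    ∃ k, K ⊆ Set.range ((homotopyQuotientCocone X P).ι.app k) := by
  obtain ⟨k, hk⟩ := exists_subset_range_toBorel X hK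
  refine ⟨k, hk.trans ?_⟩
  rintro _ ⟨z, rfl⟩
  exact ⟨_, geometricQuotientToBorel_apply X P k z⟩

end Cocone

end BorelStiefel

end

theorem mainTheorem10 {G : Type*} [Group G] [Finite G]
    [MulAction G (Fin (Nat.card G))] [FaithfulSMul G (Fin (Nat.card G))]
    {d : ℕ} (X : BorelStiefel.GASSet G d)
    (P : BorelStiefel.CompatibleGenerators X.rep (Nat.card G)) :
    ∃ ι : BorelStiefel.geometricQuotientSystem X P ⟶
        (CategoryTheory.Functor.const ℕ).obj (BorelStiefel.homotopyQuotient X),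
      (∀ (k : ℕ) (x : X.carrier) (v : BorelStiefel.Stiefel (Nat.card G) k),
        ι.app k ⟨BorelStiefel.quotientMap X P k (x, v), Set.mem_range_self (x, v)⟩ =
          (Quotient.mk _ (x, v.toInf) :
            BorelStiefel.BorelConstruction G X.carrier (BorelStiefel.StiefelInf (Nat.card G)))) ∧
      ∀ q : ℕ,
        (∃ e : colimit (BorelStiefel.geometricQuotientSystem X P ⋙
              BorelStiefel.singularHomology q) ≅ BorelStiefel.equivariantHomology X q,
          ∀ k : ℕ, colimit.ι (BorelStiefel.geometricQuotientSystem X P ⋙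
              BorelStiefel.singularHomology q) k ≫ e.hom =
            (BorelStiefel.singularHomology q).map (ι.app k)) ∧
        (∃ e : BorelStiefel.equivariantCohomology X q ≅
              limit ((BorelStiefel.geometricQuotientSystem X P).op ⋙
                BorelStiefel.singularCohomology q),
          ∀ k : ℕ, e.hom ≫ limit.π ((BorelStiefel.geometricQuotientSystem X P).op ⋙
              BorelStiefel.singularCohomology q) (op k) =
            (BorelStiefel.singularCohomology q).map (ι.app k).op) := by
  let c := BorelStiefel.homotopyQuotientCocone X P
  refine ⟨c.ι, fun k x v => BorelStiefel.geometricQuotientToBorel_apply X P k (x, v), fun q => ?_⟩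
  have hc : IsColimit ((BorelStiefel.singularHomology q).mapCocone c) :=
    BorelStiefel.isColimitMapSingularHomology c
      (fun k => (BorelStiefel.isClosedEmbedding_geometricQuotientToBorel X P k).isEmbedding)
      (BorelStiefel.homotopyQuotientCocone_compactlyExhausted X P) q
  have hc' := BorelStiefel.isLimitMapCohomology c q hc
  exact ⟨⟨(colimit.isColimit _).coconePointUniqueUpToIso hc,
      fun k => (colimit.isColimit _).comp_coconePointUniqueUpToIso_hom hc k⟩,
    ⟨hc'.conePointUniqueUpToIso (limit.isLimit _),
      fun k => hc'.conePointUniqueUpToIso_hom_comp (limit.isLimit _) (op k)⟩⟩
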